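/- Let $q$ be an indeterminate (or, more generally, any invertible element of a commutative ring), and define $S_n(q)$ for $n\ge 0$ by $S_0(q)=1$ and $$S_n(q)=q^{2n-1}S_{n-1}(q)+\sum_{k=0}^{n-1}q^{2(k+1)(n-1-k)}S_{n-1-k}(q)S_k(q)\qquad(n\ge 1).$$ A Schröder path from $(0,0)$ to $(2n,0)$ is a lattice path with steps $(1,1)$ (rise), $(1,-1)$ (fall) and $(2,0)$ (level) that never goes below the horizontal axis. Let its weight be the product of the weights of its steps, where a rise starting at $(x,y)$ has weight $q^{x-y}$, a level step starting at $(x,y)$ has weight $q^{x-y+1}$, and a fall has weight $1$. Then, for all $n\ge 0$, $S_n(q)$ is the sum of the weights of all Schröder paths from $(0,0)$ to $(2n,0)$. Moreover, let $$S^{(t)}_n(q)=\left(q^{(i-j)(i-j-1)}S_{i+j+t}(q)\right)_{0\le i,j\le n-1},$$ where the determinant of the empty matrix ($n=0$) is $1$. Then for every positive integer $n$: (i) $\displaystyle \det S^{(1)}_{n-1}(q)=\det S^{(0)}_{n}(q)=\prod_{k=1}^{n-1}(q^{2k-1}+1)^{n-k}.$ (ii) $\displaystyle \det S^{(2)}_n(q)=q^{-1}\prod_{k=1}^n(q^{2k-1}+1)^{n+1-k}\left(\prod_{k=1}^{n+1}(q^{2k-1}+1)-1\right).$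 -/

import Mathlib

open Finset

/-- The polynomials `S_n(q)`, evaluated at an element `q` of a commutative ring:
`S_0(q) = 1` and, with `n + 1` in place of `n`,
`S_{n+1}(q) = q^{2n+1} S_n(q) + ∑_{k=0}^{n} q^{2(k+1)(n-k)} S_{n-k}(q) S_k(q)`. -/
def qSchroder {R : Type*} [CommRing R] (q : R) : ℕ → R
  | 0 => 1
  | n + 1 => q ^ (2 * n + 1) * qSchroder q n +
      ∑ k : Fin (n + 1), q ^ (2 * ((k : ℕ) + 1) * (n - k)) *
        qSchroder q (n - k) * qSchroder q k

/-- The defining recurrence, with `n ≥ 1` and sums over `0 ≤ k ≤ n - 1`. -/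
theorem qSchroder_recurrence {R : Type*} [CommRing R] (q : R) (n : ℕ) (hn : 1 ≤ n) :
    qSchroder q n = q ^ (2 * n - 1) * qSchroder q (n - 1) +
      ∑ k ∈ range n, q ^ (2 * (k + 1) * (n - 1 - k)) *
        qSchroder q (n - 1 - k) * qSchroder q k := by
  obtain ⟨m, rfl⟩ : ∃ m, n = m + 1 := ⟨n - 1, by omega⟩
  rw [qSchroder, Finset.sum_range]
  rfl

/-- The `n × n` matrix `(q^{(i-j)(i-j-1)} S_{i+j+t}(q))_{0 ≤ i, j ≤ n-1}`;
the exponent `(i-j)(i-j-1)` is computed in `ℤ`. -/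
def qSchroderMatrix {R : Type*} [CommRing R] (q : Rˣ) (t n : ℕ) :
    Matrix (Fin n) (Fin n) R :=
  Matrix.of fun i j =>
    ((q ^ (((i : ℤ) - (j : ℤ)) * ((i : ℤ) - (j : ℤ) - 1)) : Rˣ) : R) *
      qSchroder (q : R) ((i : ℕ) + (j : ℕ) + t)

/-- The steps of a Schröder path: `rise = (1, 1)`, `fall = (1, -1)`, `level = (2, 0)`. -/
inductive SchroderStep
  | rise
  | fall
  | level

namespace SchroderStep

/-- Horizontal displacement. -/
def dx : SchroderStep → ℤ
  | rise => 1
  | fall => 1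
  | level => 2

/-- Vertical displacement. -/
def dy : SchroderStep → ℤ
  | rise => 1
  | fall => -1
  | level => 0

theorem one_le_dx (s : SchroderStep) : 1 ≤ s.dx := by
  cases s <;> simp [dx]

instance : Finite SchroderStep :=
  Finite.of_surjective
    (fun i : Fin 3 => if i = 0 then rise else if i = 1 then fall else level)
    (by
      intro s
      cases s
      · exact ⟨0, by simp⟩
      · exact ⟨1, by simp⟩
      · exact ⟨2, by simp⟩)

end SchroderStep

/-- Schröder paths from `(0, 0)` to `(2n, 0)`, as lists of steps: the path ends at `(2n, 0)`
and none of its vertices lies below the horizontal axis. -/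
def schroderPaths (n : ℕ) : Set (List SchroderStep) :=
  {P | (P.map SchroderStep.dx).sum = 2 * (n : ℤ) ∧ (P.map SchroderStep.dy).sum = 0 ∧
    ∀ Q : List SchroderStep, Q <+: P → 0 ≤ (Q.map SchroderStep.dy).sum}

theorem schroderPaths_finite (n : ℕ) : (schroderPaths n).Finite := by
  refine (List.finite_length_le SchroderStep (2 * n)).subset ?_
  intro P hP
  have key : ∀ P : List SchroderStep, (P.length : ℤ) ≤ (P.map SchroderStep.dx).sum := by
    intro P
    induction P with
    | nil => simp
    | cons s P ih =>
      have := s.one_le_dx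
      simp only [List.length_cons, List.map_cons, List.sum_cons, Nat.cast_add, Nat.cast_one]
      linarith
  have h1 := key P
  have h2 := hP.1
  show P.length ≤ 2 * n
  omega

/-- The weight of a path starting at the point `(x, y)`, namely the product of the weights of
its steps: starting at `(x, y)`, a rise has weight `q^{x-y}`, a level step has weight
`q^{x-y+1}`, and a fall has weight `1`. -/
def schroderWeight {R : Type*} [CommRing R] (q : Rˣ) : ℤ → ℤ → List SchroderStep → R
  | _, _, [] => 1
  | x, y, SchroderStep.rise :: P =>
      ((q ^ (x - y) : Rˣ) : R) * schroderWeight q (x + 1) (y + 1) P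
  | x, y, SchroderStep.fall :: P => schroderWeight q (x + 1) (y - 1) P
  | x, y, SchroderStep.level :: P =>
      ((q ^ (x - y + 1) : Rˣ) : R) * schroderWeight q (x + 2) y P

/-!
Schröder paths. A step other than a fall that starts further right by `d` gains a factor `q ^ d`,
and such steps are counted by the semilength, so cutting a path at its first return to the axis
gives the recurrence for `S_n(q)`. The cut is made at the level of weights of paths that start at
an arbitrary height (`suffixWeight_add`), where it follows by induction on the first step.

Determinants. Since `(i - j)(i - j - 1) + (i + j + t) ^ 2` is a function of `i` plus a function of
`j`, the matrix is, up to diagonal factors, the Hankel matrix of `μ_n = q ^ (-n ^ 2) S_n(q)`.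
The generating function of `μ` is the case `a = q⁻¹`, `Q = q ^ (-2)` of the solution of
`M_a(x) = 1 + x M_a(x) + a x M_a(x) M_a(Q x)`. This equation yields two levels of a Stieltjes
continued fraction, with a tail of the same family (`momentSeries_continuedFraction`):
`M_a(x) = 1 / (1 - c x / (1 - b x N(x)))`, where `c = 1 + a`, `b = a Q` and `N(x) = M_{aQ}(Q x)`.

Hankel determinants descend along the continued fraction. The kernel `∑ F_{i+j} x^i y^j` equals
`(x F(x) - y F(y)) / (x - y)`, and similarly for shifted indices. Multiplying a kernel by
`T(x) T(y)` with `T(0) = 1` multiplies its matrix by unitriangular Toeplitz matrices, so no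
determinant changes. With `T` the denominator of `M_a` the kernels of `M_a` become simple
expressions in those of `N`, which gives `hankelDet_zero_succ`, `hankelDet_one_succ` and
`hankelDet_two_succ`, without division in the ring. Iterating them over `a = q ^ (-(2 j + 1))`
gives the products; for the shift by two there are two terms, and
`q ^ (2 j + 1) + (q ^ (2 j + 1) + 1) (W - 1) = (q ^ (2 j + 1) + 1) W - 1` makes them combine.
-/

/-! ### Schröder paths and the recurrence -/

/-- The lattice paths from height `h` down to the axis, staying weakly above it, that have
exactly `m` steps other than falls. They are generated by their first step. -/
def schroderSuffixes : ℕ → ℕ → Finset (List SchroderStep)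
  | 0, 0 => {[]}
  | 0, h + 1 => (schroderSuffixes 0 h).map ⟨_, List.cons_injective (a := SchroderStep.fall)⟩
  | m + 1, 0 =>
      ((schroderSuffixes m 1).map ⟨_, List.cons_injective (a := SchroderStep.rise)⟩).disjUnion
        ((schroderSuffixes m 0).map ⟨_, List.cons_injective (a := SchroderStep.level)⟩)
        (by simp [Finset.disjoint_left])
  | m + 1, h + 1 =>
      (((schroderSuffixes m (h + 2)).map
          ⟨_, List.cons_injective (a := SchroderStep.rise)⟩).disjUnion
        ((schroderSuffixes m (h + 1)).map ⟨_, List.cons_injective (a := SchroderStep.level)⟩)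
        (by simp [Finset.disjoint_left])).disjUnion
      ((schroderSuffixes (m + 1) h).map ⟨_, List.cons_injective (a := SchroderStep.fall)⟩)
        (by simp only [Finset.disjoint_left]; simp; grind)
termination_by m h => (m, h)

/-- A path counted by `schroderSuffixes m h` has width `2 m + h`: it has `h` more falls than rises,
and its rises and level steps number `m`. -/
theorem mem_schroderSuffixes (P : List SchroderStep) : ∀ m h : ℕ,
    P ∈ schroderSuffixes m h ↔ (P.map SchroderStep.dx).sum = 2 * (m : ℤ) + h ∧
      (P.map SchroderStep.dy).sum = -(h : ℤ) ∧
      ∀ Q : List SchroderStep, Q <+: P → 0 ≤ (h : ℤ) + (Q.map SchroderStep.dy).sum := by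
  induction P with
  | nil =>
    intro m h
    rcases m with _ | m <;> rcases h with _ | h <;> simp [schroderSuffixes] <;> omega
  | cons s P ih =>
    intro m h
    have hpre : (∀ Q : List SchroderStep, Q <+: s :: P →
        0 ≤ (h : ℤ) + (Q.map SchroderStep.dy).sum) ↔
        ∀ Q : List SchroderStep, Q <+: P → 0 ≤ (h : ℤ) + s.dy + (Q.map SchroderStep.dy).sum := by
      constructor
      · intro H Q hQ
        have := H (s :: Q) ((List.prefix_cons_inj s).2 hQ)
        simpa [add_assoc] using this
      · intro H Q hQ
        rcases List.prefix_cons_iff.1 hQ with rfl | ⟨t, rfl, ht⟩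
        · simp
        · simpa [add_assoc] using H t ht
    rw [hpre]
    have hnil : (∀ Q : List SchroderStep, Q <+: P →
        0 ≤ (h : ℤ) + s.dy + (Q.map SchroderStep.dy).sum) → 0 ≤ (h : ℤ) + s.dy + 0 :=
      fun H => H [] List.nil_prefix
    -- a step other than a fall has `dx + dy = 2`, so none occurs when `m = 0`
    have hP : 0 ≤ (P.map SchroderStep.dx).sum + (P.map SchroderStep.dy).sum := by
      clear ih hpre hnil
      induction P with
      | nil => simp
      | cons s P ih => cases s <;> simp [SchroderStep.dx, SchroderStep.dy] at * <;> omega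
    rcases m with _ | m <;> rcases h with _ | h <;> cases s <;>
      simp [schroderSuffixes, ih, SchroderStep.dx, SchroderStep.dy] at hnil ⊢ <;>
      first
      | (intros; omega)
      | exact fun _ _ => hnil
      | (constructor <;> rintro ⟨h1, h2, h3⟩ <;>
          exact ⟨by omega, by omega, fun Q hQ => by have := h3 Q hQ; omega⟩)

theorem toFinset_schroderPaths (n : ℕ) :
    (schroderPaths_finite n).toFinset = schroderSuffixes n 0 := by
  ext P
  simp [mem_schroderSuffixes, schroderPaths]

theorem schroderWeight_translate {R : Type*} [CommRing R] (q : Rˣ) (P : List SchroderStep) :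
    ∀ x y c : ℤ, (schroderWeight q (x + c) (y + c) P : R) = schroderWeight q x y P := by
  induction P with
  | nil => intros; rfl
  | cons s P ih =>
    intro x y c
    cases s
    · simp only [schroderWeight, add_sub_add_right_eq_sub]
      rw [show x + c + 1 = x + 1 + c by ring, show y + c + 1 = y + 1 + c by ring, ih]
    · simp only [schroderWeight]
      rw [show x + c + 1 = x + 1 + c by ring, show y + c - 1 = y - 1 + c by ring, ih]
    · simp only [schroderWeight, add_sub_add_right_eq_sub]
      rw [show x + c + 2 = x + 2 + c by ring, ih]

/-- Moving a path to the right by `d` multiplies the weight of each step other than a fall by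
`q ^ d`; the hypothesis says that there are `m` such steps, as they have `dx + dy = 2`. -/
theorem schroderWeight_shift {R : Type*} [CommRing R] (q : Rˣ) (P : List SchroderStep) :
    ∀ x y d m : ℤ, (P.map SchroderStep.dx).sum + (P.map SchroderStep.dy).sum = 2 * m →
      (schroderWeight q (x + d) y P : R) =
        ((q ^ (d * m) : Rˣ) : R) * schroderWeight q x y P := by
  induction P with
  | nil =>
    intro x y d m h
    obtain rfl : m = 0 := by simp at h; omega
    simp [schroderWeight]
  | cons s P ih =>
    intro x y d m h
    cases s
    · simp only [List.map_cons, List.sum_cons, SchroderStep.dx, SchroderStep.dy] at h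
      simp only [schroderWeight]
      rw [show x + d + 1 = x + 1 + d by ring, ih _ _ _ (m - 1) (by omega), ← mul_assoc, ← mul_assoc,
        ← Units.val_mul, ← Units.val_mul, ← zpow_add, ← zpow_add]
      congr 3; ring
    · simp only [List.map_cons, List.sum_cons, SchroderStep.dx, SchroderStep.dy] at h
      simp only [schroderWeight]
      rw [show x + d + 1 = x + 1 + d by ring, ih _ _ _ m (by omega)]
    · simp only [List.map_cons, List.sum_cons, SchroderStep.dx, SchroderStep.dy] at h
      simp only [schroderWeight]
      rw [show x + d + 2 = x + 2 + d by ring, ih _ _ _ (m - 1) (by omega), ← mul_assoc, ← mul_assoc,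
        ← Units.val_mul, ← Units.val_mul, ← zpow_add, ← zpow_add]
      congr 3; ring

theorem schroderWeight_of_mem_schroderSuffixes {R : Type*} [CommRing R] (q : Rˣ)
    {P : List SchroderStep} {m h : ℕ} (hP : P ∈ schroderSuffixes m h) (d y : ℕ) :
    (schroderWeight q (d + y) y P : R) = (q : R) ^ (d * m) * schroderWeight q 0 0 P := by
  obtain ⟨h1, h2, -⟩ := (mem_schroderSuffixes P m h).1 hP
  have h3 := schroderWeight_shift q P y y d m (by omega)
  have h4 := schroderWeight_translate q P 0 0 y
  rw [zero_add] at h4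
  rw [add_comm (d : ℤ), h3, h4]
  norm_cast

/-- The total weight of the paths in `schroderSuffixes m h`, started on the diagonal `x = y`. -/
def suffixWeight {R : Type*} [CommRing R] (q : Rˣ) (m h : ℕ) : R :=
  ∑ P ∈ schroderSuffixes m h, schroderWeight q 0 0 P

section
variable {R : Type*} [CommRing R] (q : Rˣ)

theorem sum_rise (m h : ℕ) : ∑ P ∈ schroderSuffixes m h,
    (schroderWeight q 0 0 (SchroderStep.rise :: P) : R) = suffixWeight q m h := by
  refine Finset.sum_congr rfl fun P hP => ?_
  have := schroderWeight_of_mem_schroderSuffixes (R := R) q hP 0 1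
  simpa [schroderWeight] using this

theorem sum_level (m h : ℕ) : ∑ P ∈ schroderSuffixes m h,
    (schroderWeight q 0 0 (SchroderStep.level :: P) : R) =
      (q : R) ^ (2 * m + 1) * suffixWeight q m h := by
  rw [suffixWeight, Finset.mul_sum]
  refine Finset.sum_congr rfl fun P hP => ?_
  have := schroderWeight_of_mem_schroderSuffixes (R := R) q hP 2 0
  simp only [Nat.cast_ofNat, Nat.cast_zero, add_zero] at this
  simp only [schroderWeight, zero_add, this]
  simp only [sub_self, zero_add, zpow_one]
  ring

theorem sum_fall (m h : ℕ) : ∑ P ∈ schroderSuffixes m h,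
    (schroderWeight q 0 0 (SchroderStep.fall :: P) : R) =
      (q : R) ^ (2 * m) * suffixWeight q m h := by
  rw [suffixWeight, Finset.mul_sum]
  refine Finset.sum_congr rfl fun P hP => ?_
  have := schroderWeight_of_mem_schroderSuffixes (R := R) q hP 2 0
  have h4 := schroderWeight_translate (R := R) q P 1 (-1) 1
  simp only [Nat.cast_ofNat, Nat.cast_zero, add_zero] at this
  norm_num at h4
  simp only [schroderWeight, zero_add, zero_sub, ← h4, this]

theorem suffixWeight_zero_zero : (suffixWeight q 0 0 : R) = 1 := by
  simp [suffixWeight, schroderSuffixes, schroderWeight]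

theorem suffixWeight_zero_succ (h : ℕ) :
    (suffixWeight q 0 (h + 1) : R) = suffixWeight q 0 h := by
  rw [suffixWeight, schroderSuffixes, Finset.sum_map]
  simpa using sum_fall q 0 h

theorem suffixWeight_succ_zero (m : ℕ) : (suffixWeight q (m + 1) 0 : R) =
    suffixWeight q m 1 + (q : R) ^ (2 * m + 1) * suffixWeight q m 0 := by
  rw [suffixWeight, schroderSuffixes, Finset.sum_disjUnion, Finset.sum_map, Finset.sum_map]
  exact congrArg₂ _ (sum_rise q m 1) (sum_level q m 0)

theorem suffixWeight_succ_succ (m h : ℕ) : (suffixWeight q (m + 1) (h + 1) : R) =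
    suffixWeight q m (h + 2) + (q : R) ^ (2 * m + 1) * suffixWeight q m (h + 1) +
      (q : R) ^ (2 * (m + 1)) * suffixWeight q (m + 1) h := by
  rw [suffixWeight, schroderSuffixes, Finset.sum_disjUnion, Finset.sum_disjUnion, Finset.sum_map,
    Finset.sum_map, Finset.sum_map]
  exact congrArg₂ _ (congrArg₂ _ (sum_rise q m _) (sum_level q m _)) (sum_fall q _ h)

/-- Cutting a path from height `h₁ + 1 + h₂` at the fall by which it first reaches height `h₂`.
If `k` steps other than falls precede this fall, it ends at `x - y = 2 * (h₁ + k + 1)`. -/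
theorem suffixWeight_add (h₂ m : ℕ) : ∀ h₁ : ℕ, (suffixWeight q m (h₁ + 1 + h₂) : R) =
    ∑ p ∈ antidiagonal m, (q : R) ^ (2 * (h₁ + p.1 + 1) * p.2) *
      suffixWeight q p.1 h₁ * suffixWeight q p.2 h₂ := by
  induction m with
  | zero =>
    intro h₁
    have : ∀ h, (suffixWeight q 0 h : R) = 1 := fun h => by
      induction h with
      | zero => exact suffixWeight_zero_zero q
      | succ h ih => rw [suffixWeight_zero_succ, ih]
    simp [this]
  | succ m ihm =>
    intro h₁
    induction h₁ with
    | zero =>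
      rw [show 0 + 1 + h₂ = h₂ + 1 by ring, suffixWeight_succ_succ,
        show h₂ + 2 = 1 + 1 + h₂ by ring, show h₂ + 1 = 0 + 1 + h₂ by ring, ihm, ihm,
        Finset.Nat.sum_antidiagonal_succ, suffixWeight_zero_zero]
      simp only [suffixWeight_succ_zero, Finset.mul_sum]
      rw [← Finset.sum_add_distrib, add_comm]
      congr 1
      · ring
      · refine Finset.sum_congr rfl fun p hp => ?_
        rw [← Finset.HasAntidiagonal.mem_antidiagonal.1 hp]
        ring
    | succ h₁ ih =>
      rw [show h₁ + 1 + 1 + h₂ = h₁ + 1 + h₂ + 1 by ring, suffixWeight_succ_succ, ih,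
        show h₁ + 1 + h₂ + 2 = h₁ + 2 + 1 + h₂ by ring,
        show h₁ + 1 + h₂ + 1 = h₁ + 1 + 1 + h₂ by ring, ihm, ihm,
        Finset.Nat.sum_antidiagonal_succ, Finset.Nat.sum_antidiagonal_succ, suffixWeight_zero_succ]
      simp only [suffixWeight_succ_succ, Finset.mul_sum, mul_add]
      rw [← Finset.sum_add_distrib, add_left_comm, ← Finset.sum_add_distrib]
      congr 1
      · ring
      · refine Finset.sum_congr rfl fun p hp => ?_
        rw [← Finset.HasAntidiagonal.mem_antidiagonal.1 hp]
        ring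

theorem qSchroder_eq_suffixWeight (n : ℕ) : qSchroder (q : R) n = suffixWeight q n 0 := by
  induction n using Nat.strong_induction_on with
  | _ n ih =>
    rcases n with _ | n
    · rw [qSchroder, suffixWeight_zero_zero]
    · have h := suffixWeight_add (R := R) q 0 n 0
      rw [Finset.Nat.sum_antidiagonal_eq_sum_range_succ_mk, Finset.sum_range] at h
      rw [suffixWeight_succ_zero, h, qSchroder, ih n (by omega), add_comm]
      congr 1
      refine Finset.sum_congr rfl fun k _ => ?_
      rw [ih _ (by omega), ih _ (by omega), zero_add]
      ring

end

/-! ### The continued fraction of the generating function -/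

section
variable {R : Type*} [CommRing R]

/-- The moments `m n` whose generating function satisfies
`M_a(x) = 1 + x M_a(x) + a x M_a(x) M_a(Q x)`. -/
def moment (a Q : R) : ℕ → R
  | 0 => 1
  | n + 1 => moment a Q n + ∑ k : Fin (n + 1), a * Q ^ (k : ℕ) * moment a Q (n - k) * moment a Q k

/-- The generating function of `moment a Q`. -/
noncomputable def momentSeries (a Q : R) : PowerSeries R := PowerSeries.mk (moment a Q)

open PowerSeries

/-- The functional equation of `momentSeries a Q` determines its coefficients recursively. -/
theorem eq_momentSeries_iff (a Q : R) (W : PowerSeries R) :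
    W = momentSeries a Q ↔ W = 1 + X * W + C a * X * W * rescale Q W := by
  have key : W = 1 + X * W + C a * X * W * rescale Q W ↔ coeff 0 W = 1 ∧
      ∀ n, coeff (n + 1) W = coeff n W +
        ∑ k : Fin (n + 1), a * Q ^ (k : ℕ) * coeff (n - k) W * coeff k W := by
    have h0 : coeff 0 (1 + X * W + C a * X * W * rescale Q W) = 1 := by
      simp
    have hs : ∀ n, coeff (n + 1) (1 + X * W + C a * X * W * rescale Q W) = coeff n W +
        ∑ k : Fin (n + 1), a * Q ^ (k : ℕ) * coeff (n - k) W * coeff k W := by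
      intro n
      rw [show 1 + X * W + C a * X * W * rescale Q W =
        1 + (X * W + X * (C a * (rescale Q W * W))) by ring]
      rw [map_add, map_add, coeff_succ_X_mul, coeff_succ_X_mul, coeff_C_mul, coeff_mul,
        Finset.Nat.sum_antidiagonal_eq_sum_range_succ_mk, Finset.sum_range, Finset.mul_sum]
      rw [coeff_one, if_neg (by omega), zero_add]
      congr 1
      refine Finset.sum_congr rfl fun k _ => ?_
      rw [coeff_rescale]
      ring
    constructor
    · intro h
      refine ⟨(congrArg (coeff 0) h).trans h0, fun n => (congrArg (coeff (n + 1)) h).trans (hs n)⟩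
    · rintro ⟨h1, h2⟩
      ext n
      rcases n with _ | n
      · rw [h0, h1]
      · rw [hs, h2]
  rw [key]
  constructor
  · rintro rfl
    simp only [momentSeries, coeff_mk]
    exact ⟨by rw [moment], fun n => by rw [moment]⟩
  · rintro ⟨h0, hs⟩
    ext n
    rw [momentSeries, coeff_mk]
    induction n using Nat.strong_induction_on with
    | _ n ih =>
      rcases n with _ | n
      · rw [h0, moment]
      · rw [hs, moment, ih n (by omega)]
        congr 1
        refine Finset.sum_congr rfl fun k _ => ?_
        rw [ih _ (by omega), ih _ (by omega)]

/-- The continued fraction `M_a(x) = 1 / (1 - (1 + a) x / (1 - a Q x M_{aQ}(Q x)))`, with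
denominators cleared. -/
theorem momentSeries_continuedFraction (a Q : R) :
    momentSeries a Q *
        (1 - C (a * Q) * X * rescale Q (momentSeries (a * Q) Q) - C (1 + a) * X) =
      1 - C (a * Q) * X * rescale Q (momentSeries (a * Q) Q) := by
  have hC : ∀ r : R, rescale Q (C r) = C r := fun r => by
    ext n; rw [coeff_rescale, coeff_C]; split_ifs with h <;> simp [h]
  set N := rescale Q (momentSeries (a * Q) Q) with hN
  have hNeq : N = 1 + C Q * X * N + C (a * Q) * (C Q * X) * N * rescale Q N := by
    have := congrArg (rescale Q) ((eq_momentSeries_iff (a * Q) Q _).1 rfl)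
    simpa only [map_add, map_mul, map_one, rescale_X, hC, ← hN] using this
  have unit_of : ∀ f : PowerSeries R, IsUnit (1 - X * f) := fun f => by
    rw [isUnit_iff_constantCoeff]; simp
  obtain ⟨u, hu⟩ : IsUnit (1 - C (a * Q) * X * N - C (1 + a) * X) := by
    convert unit_of (C (a * Q) * N + C (1 + a)) using 1; ring
  have hV : IsUnit (1 - C (a * Q) * X * N) := by
    convert unit_of (C (a * Q) * N) using 1; ring
  -- the series `W` defined by the continued fraction satisfies the equation of `momentSeries`
  obtain ⟨W, hW⟩ : ∃ W, W * (1 - C (a * Q) * X * N - C (1 + a) * X) =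
      1 - C (a * Q) * X * N :=
    ⟨(1 - C (a * Q) * X * N) * (↑u⁻¹ : PowerSeries R), by rw [← hu, Units.inv_mul_cancel_right]⟩
  suffices W = momentSeries a Q by rw [← this, hW]
  rw [eq_momentSeries_iff]
  have hW' := congrArg (rescale Q) hW
  simp only [map_add, map_mul, map_one, rescale_X, hC, map_sub] at hW' hNeq hW ⊢
  -- multiplying by `N` lets the equation of `N` eliminate `rescale Q N`
  have h1 : rescale Q W * (1 - C a * C Q * X * N) = 1 + C Q * X * N := by
    linear_combination N * hW' - (rescale Q W - 1) * hNeq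
  apply hV.mul_left_cancel
  simp only [map_mul]
  linear_combination hW - C a * X * W * h1
end

/-! ### Hankel determinants as bilinear generating functions -/

open PowerSeries

section
variable {R : Type*} [CommRing R]

/-- The leading `n × n` block of the array of coefficients of a series in `R⟦x⟧⟦y⟧`; rows are
indexed by powers of `x`, columns by powers of `y`. -/
noncomputable def coeffMatrix (n : ℕ) (f : PowerSeries (PowerSeries R)) :
    Matrix (Fin n) (Fin n) R :=
  Matrix.of fun i j => coeff (i : ℕ) (coeff (j : ℕ) f)

/-- The Hankel kernel `∑ F (i + j + t) x ^ i y ^ j`. -/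
noncomputable def hankelKernel (t : ℕ) (F : PowerSeries R) : PowerSeries (PowerSeries R) :=
  PowerSeries.mk fun j => PowerSeries.mk fun i => coeff (i + j + t) F

/-- The lower triangular Toeplitz matrix of a power series. -/
noncomputable def toeplitz (n : ℕ) (f : PowerSeries R) : Matrix (Fin n) (Fin n) R :=
  Matrix.of fun i j => if j ≤ i then coeff ((i : ℕ) - j) f else 0

theorem det_toeplitz (n : ℕ) {f : PowerSeries R} (hf : constantCoeff f = 1) :
    (toeplitz n f).det = 1 := by
  rw [Matrix.det_of_isLowerTriangular]
  · simp [toeplitz, hf]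
  · intro i j hij
    have : ¬ j ≤ i := not_le.2 hij
    simp [toeplitz, this]

theorem sum_toeplitz (n : ℕ) (f g : PowerSeries R) (i : Fin n) :
    ∑ k : Fin n, toeplitz n f i k * coeff (k : ℕ) g = coeff (i : ℕ) (f * g) := by
  rw [mul_comm, coeff_mul, Finset.Nat.sum_antidiagonal_eq_sum_range_succ_mk]
  simp only [toeplitz, Matrix.of_apply, ite_mul, zero_mul, Fin.le_def]
  rw [Fin.sum_univ_eq_sum_range
    (fun k => if k ≤ (i : ℕ) then coeff ((i : ℕ) - k) f * coeff k g else 0) n,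
    ← Finset.sum_filter]
  refine Finset.sum_congr ?_ fun k _ => mul_comm _ _
  ext k
  simp only [Finset.mem_filter, Finset.mem_range]
  omega

theorem coeffMatrix_C_mul (n : ℕ) (f : PowerSeries R) (K : PowerSeries (PowerSeries R)) :
    coeffMatrix n (C f * K) = toeplitz n f * coeffMatrix n K := by
  ext i j
  rw [Matrix.mul_apply]
  simp only [coeffMatrix, Matrix.of_apply, coeff_C_mul, sum_toeplitz]

theorem coeffMatrix_map_mul (n : ℕ) (f : PowerSeries R) (K : PowerSeries (PowerSeries R)) :
    coeffMatrix n (map C f * K) = coeffMatrix n K * (toeplitz n f).transpose := by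
  ext i j
  have h : ∀ i j : ℕ, coeff i (coeff j (map C f * K)) =
      coeff j (f * PowerSeries.mk fun l => coeff i (coeff l K)) := by
    intro i j
    rw [coeff_mul, coeff_mul, map_sum]
    simp only [coeff_map, coeff_C_mul, coeff_mk]
  rw [Matrix.mul_apply]
  simp only [coeffMatrix, Matrix.of_apply, Matrix.transpose_apply]
  rw [h, ← sum_toeplitz]
  simp only [coeff_mk]
  exact Finset.sum_congr rfl fun k _ => mul_comm _ _

/-- Multiplying a kernel by `T(x) T(y)` with `T(0) = 1` does not change its determinants. -/
theorem det_coeffMatrix_mul (n : ℕ) {T : PowerSeries R} (hT : constantCoeff T = 1)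
    (K : PowerSeries (PowerSeries R)) :
    (coeffMatrix n (C T * (map C T * K))).det = (coeffMatrix n K).det := by
  rw [coeffMatrix_C_mul, coeffMatrix_map_mul, Matrix.det_mul, Matrix.det_mul,
    Matrix.det_transpose, det_toeplitz n hT, one_mul, mul_one]

theorem eq_of_C_X_mul_eq {f g : PowerSeries (PowerSeries R)} (h : C X * f = C X * g) :
    f = g := by
  ext1 n
  apply X_mul_cancel
  simpa only [coeff_C_mul] using congrArg (coeff n) h

/-- Cancelling `x - y` in `R⟦x⟧⟦y⟧`, where `x` is `C X` and `y` is `X`. -/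
theorem eq_of_sub_mul_eq {f g : PowerSeries (PowerSeries R)}
    (h : (C X - X) * f = (C X - X) * g) : f = g := by
  ext1 n
  apply X_mul_cancel
  have := congrArg (coeff n) h
  induction n with
  | zero => simpa only [sub_mul, map_sub, coeff_C_mul, coeff_zero_X_mul, sub_zero] using this
  | succ n ih =>
    simp only [sub_mul, map_sub, coeff_C_mul, coeff_succ_X_mul] at this
    rw [X_mul_cancel (ih (congrArg (coeff n) h))] at this
    exact sub_left_injective this

/-- `(x - y) ∑ F_{i+j} x^i y^j = x F(x) - y F(y)`; a series in `y` alone is an image of `map C`. -/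
theorem hankelKernel_zero (F : PowerSeries R) :
    (C X - X) * hankelKernel 0 F = C (X * F) - X * map C F := by
  ext j i
  rcases j with _ | j <;> rcases i with _ | i <;>
    simp only [sub_mul, hankelKernel, coeff_succ_X_mul, coeff_zero_X_mul, map_sub, coeff_C_mul,
      coeff_mk, coeff_map, coeff_C, map_zero] <;>
    simp
  rw [add_right_comm, add_assoc, sub_self]

theorem hankelKernel_one (F : PowerSeries R) :
    (C X - X) * hankelKernel 1 F = C F - map C F := by
  ext j i
  rcases j with _ | j <;> rcases i with _ | i <;>
    simp only [sub_mul, hankelKernel, coeff_succ_X_mul, coeff_zero_X_mul, map_sub, coeff_C_mul,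
      coeff_mk, coeff_map, coeff_C, map_zero] <;>
    simp
  rw [show i + 1 + j + 1 = i + (j + 1) + 1 by ring, sub_self]

/-- The kernel of the twice shifted coefficients, multiplied by `x y (x - y)` to clear
denominators. -/
theorem hankelKernel_two (F : PowerSeries R) :
    (C X - X) * (C X * (X * hankelKernel 2 F)) =
      X * C F - C X * map C F + (C X - X) * C (C (constantCoeff F)) := by
  rw [sub_mul, sub_mul, show C X * (C X * (X * hankelKernel 2 F)) =
    X * (C X * (C X * hankelKernel 2 F)) by ring, show X * (C X * (X * hankelKernel 2 F)) =
    X * (X * (C X * hankelKernel 2 F)) by ring]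
  ext j i
  rcases j with _ | _ | j <;> rcases i with _ | _ | i <;>
    simp only [hankelKernel, coeff_succ_X_mul, coeff_zero_X_mul, map_sub, map_add, coeff_C_mul,
      coeff_mk, coeff_map, coeff_C, map_zero] <;>
    simp [coeff_C]
  rw [show i + 1 + j + 2 = i + (j + 1) + 2 by ring, sub_self]
end

/-! ### Recurrences for Hankel determinants of a continued fraction -/

section
variable {R : Type*} [CommRing R]

/-- The Hankel determinant `det (F (i + j + t))` of size `n` of the coefficients of `F`. -/
noncomputable def hankelDet (t n : ℕ) (F : PowerSeries R) : R :=
  (coeffMatrix n (hankelKernel t F)).det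

theorem hankelDet_eq (t n : ℕ) (F : PowerSeries R) : hankelDet t n F =
    (Matrix.of fun i j : Fin n => coeff ((i : ℕ) + j + t) F).det := by
  simp only [hankelDet, coeffMatrix, hankelKernel, coeff_mk]

theorem coeffMatrix_smul (n : ℕ) (r : R) (K : PowerSeries (PowerSeries R)) :
    coeffMatrix n (C (C r) * K) = r • coeffMatrix n K := by
  ext i j
  simp [coeffMatrix, coeff_C_mul]

/-- The matrix of `1 + x y K` is block diagonal, with blocks `1` and the matrix of `K`. -/
theorem det_coeffMatrix_one_add (n : ℕ) (K : PowerSeries (PowerSeries R)) :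
    (coeffMatrix (n + 1) (1 + C X * (X * K))).det = (coeffMatrix n K).det := by
  rw [Matrix.det_succ_row_zero, Fin.sum_univ_succ, Finset.sum_eq_zero, add_zero]
  · have h1 : coeffMatrix (n + 1) (1 + C X * (X * K)) 0 0 = 1 := by
      simp [coeffMatrix]
    rw [h1]
    simp only [Fin.val_zero, pow_zero, one_mul, Fin.succAbove_zero]
    congr 1
    ext i j
    simp [coeffMatrix, coeff_C_mul, coeff_succ_X_mul, coeff_one]
  · intro j _
    have h1 : coeffMatrix (n + 1) (1 + C X * (X * K)) 0 j.succ = 0 := by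
      simp [coeffMatrix, coeff_C_mul, coeff_succ_X_mul, coeff_one]
    rw [h1, mul_zero, zero_mul]

/-- Adding a constant to the kernel changes only the corner entry of a Hankel matrix, whose minor is
the Hankel matrix shifted by two. -/
theorem det_coeffMatrix_add_C (n : ℕ) (d e : R) (F : PowerSeries R) :
    (coeffMatrix (n + 1) (C (C d) * hankelKernel 0 F + C (C e))).det =
      d ^ (n + 1) * hankelDet 0 (n + 1) F + e * d ^ n * hankelDet 2 n F := by
  have hminor : ∀ j : Fin (n + 1),
      (coeffMatrix (n + 1) (C (C d) * hankelKernel 0 F + C (C e))).submatrix Fin.succ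
        (Fin.succAbove j) = (coeffMatrix (n + 1) (C (C d) * hankelKernel 0 F)).submatrix Fin.succ
        (Fin.succAbove j) := by
    intro j
    ext i k
    simp [coeffMatrix, coeff_C]
    split_ifs <;> simp
  have hentry : ∀ j : Fin n, coeffMatrix (n + 1) (C (C d) * hankelKernel 0 F + C (C e)) 0 j.succ =
      coeffMatrix (n + 1) (C (C d) * hankelKernel 0 F) 0 j.succ := by
    intro j
    simp [coeffMatrix, coeff_C]
  have hcorner : coeffMatrix (n + 1) (C (C d) * hankelKernel 0 F + C (C e)) 0 0 =
      coeffMatrix (n + 1) (C (C d) * hankelKernel 0 F) 0 0 + e := by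
    simp [coeffMatrix]
  have hshift : (coeffMatrix (n + 1) (C (C d) * hankelKernel 0 F)).submatrix Fin.succ
      (Fin.succAbove 0) = d • coeffMatrix n (hankelKernel 2 F) := by
    ext i j
    simp [coeffMatrix, coeff_C_mul, hankelKernel]
    rw [show (i : ℕ) + 1 + (j + 1) = i + j + 2 by ring]
  have hdet : (coeffMatrix (n + 1) (C (C d) * hankelKernel 0 F)).det =
      d ^ (n + 1) * hankelDet 0 (n + 1) F := by
    rw [coeffMatrix_smul, Matrix.det_smul, Fintype.card_fin, hankelDet]
  rw [← hdet, Matrix.det_succ_row_zero, Matrix.det_succ_row_zero (coeffMatrix (n + 1)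
    (C (C d) * hankelKernel 0 F)), Fin.sum_univ_succ, Fin.sum_univ_succ]
  simp only [hminor, hentry, hcorner, hshift, Matrix.det_smul, Fintype.card_fin]
  simp only [Fin.val_zero, pow_zero, one_mul, hankelDet]
  ring

section ContinuedFraction
variable {b c : R} {M N : PowerSeries R}

theorem hankelDet_zero_succ (h : M * (1 - C b * X * N - C c * X) = 1 - C b * X * N) (n : ℕ) :
    hankelDet 0 (n + 1) M = (c * b) ^ n * hankelDet 0 n N := by
  obtain ⟨V', hV⟩ : ∃ V', (1 - C b * X * N) * V' = 1 := by
    have : IsUnit (1 - C b * X * N) := by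
      rw [isUnit_iff_constantCoeff]; simp
    exact this.exists_right_inv
  have hV0 : constantCoeff V' = 1 := by
    simpa using congrArg constantCoeff hV
  -- `U = 1 - b x N - c x` turns the kernel of `M` into `V(x) V(y) + c b x y K_N`; dividing by
  -- `V(x) V(y)`, where `V = 1 - b x N`, makes the first summand `1`
  have key : C ((1 - C b * X * N - C c * X) * V') *
      (map C ((1 - C b * X * N - C c * X) * V') * hankelKernel 0 M) =
      1 + C X * (X * (C (C (c * b)) * (C V' * (map C V' * hankelKernel 0 N)))) := by
    have hx := congrArg (C (R := PowerSeries R)) h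
    have hy := congrArg (map (C (R := R))) h
    have hVx := congrArg (C (R := PowerSeries R)) hV
    have hVy := congrArg (map (C (R := R))) hV
    have hM := hankelKernel_zero M
    have hN := hankelKernel_zero N
    simp only [map_mul, map_sub, map_one, map_C, map_X] at *
    apply eq_of_sub_mul_eq
    linear_combination (1 - C (C b) * C X * C N - C (C c) * C X) *
      (1 - C (C b) * X * map C N - C (C c) * X) * C V' * map C V' * hM +
      C X * (1 - C (C b) * X * map C N - C (C c) * X) * C V' * map C V' * hx -
      X * (1 - C (C b) * C X * C N - C (C c) * C X) * C V' * map C V' * hy -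
      C (C c) * C (C b) * C X * X * C V' * map C V' * hN +
      (C X - X) * ((1 - C (C b) * X * map C N) * map C V' * hVx + hVy)
  rw [hankelDet, ← det_coeffMatrix_mul (n + 1) (T := (1 - C b * X * N - C c * X) * V')
    (by simp [hV0]), key, det_coeffMatrix_one_add, coeffMatrix_smul, Matrix.det_smul,
    det_coeffMatrix_mul n hV0, Fintype.card_fin, hankelDet]

theorem hankelDet_one_succ (h : M * (1 - C b * X * N - C c * X) = 1 - C b * X * N) (n : ℕ) :
    hankelDet 1 (n + 1) M = c ^ (n + 1) * b ^ n * hankelDet 1 n N := by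
  have key : C (1 - C b * X * N - C c * X) *
      (map C (1 - C b * X * N - C c * X) * hankelKernel 1 M) =
      C (C c) * (1 + C X * (X * (C (C b) * hankelKernel 1 N))) := by
    have hx := congrArg (C (R := PowerSeries R)) h
    have hy := congrArg (map (C (R := R))) h
    have hM := hankelKernel_one M
    have hN := hankelKernel_one N
    simp only [map_mul, map_sub, map_one, map_C, map_X] at *
    apply eq_of_sub_mul_eq
    linear_combination (1 - C (C b) * C X * C N - C (C c) * C X) *
      (1 - C (C b) * X * map C N - C (C c) * X) * hM +
      (1 - C (C b) * X * map C N - C (C c) * X) * hx -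
      (1 - C (C b) * C X * C N - C (C c) * C X) * hy - C (C c) * C (C b) * C X * X * hN
  rw [hankelDet, ← det_coeffMatrix_mul (n + 1) (T := 1 - C b * X * N - C c * X)
    (by simp), key, coeffMatrix_smul, Matrix.det_smul, det_coeffMatrix_one_add, coeffMatrix_smul,
    Matrix.det_smul, Fintype.card_fin, Fintype.card_fin, hankelDet, mul_assoc]

theorem hankelDet_two_succ (h : M * (1 - C b * X * N - C c * X) = 1 - C b * X * N) (n : ℕ) :
    hankelDet 2 (n + 1) M = (c * b) ^ (n + 1) * hankelDet 0 (n + 1) N +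
      c ^ 2 * (c * b) ^ n * hankelDet 2 n N := by
  have hM0 : constantCoeff M = 1 := by
    simpa using congrArg constantCoeff h
  have key : C (1 - C b * X * N - C c * X) *
      (map C (1 - C b * X * N - C c * X) * hankelKernel 2 M) =
      C (C (c * b)) * hankelKernel 0 N + C (C (c ^ 2)) := by
    have hx := congrArg (C (R := PowerSeries R)) h
    have hy := congrArg (map (C (R := R))) h
    have hM := hankelKernel_two M
    have hN := hankelKernel_zero N
    simp only [map_mul, map_sub, map_one, map_C, map_X, map_pow, hM0] at *
    apply X_mul_cancel
    apply eq_of_C_X_mul_eq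
    apply eq_of_sub_mul_eq
    linear_combination (1 - C (C b) * C X * C N - C (C c) * C X) *
      (1 - C (C b) * X * map C N - C (C c) * X) * hM +
      X * (1 - C (C b) * X * map C N - C (C c) * X) * hx -
      C X * (1 - C (C b) * C X * C N - C (C c) * C X) * hy -
      C (C c) * C (C b) * C X * X * hN
  rw [hankelDet, ← det_coeffMatrix_mul (n + 1) (T := 1 - C b * X * N - C c * X)
    (by simp), key, det_coeffMatrix_add_C]

end ContinuedFraction
end

/-! ### Evaluation of the Schröder determinants -/

section
variable {R : Type*} [CommRing R]

theorem hankelDet_rescale (t n : ℕ) (Q : R) (F : PowerSeries R) :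
    hankelDet t n (rescale Q F) = (∏ i ∈ range n, Q ^ (2 * i + t)) * hankelDet t n F := by
  have h : (Matrix.of fun i j : Fin n => coeff ((i : ℕ) + j + t) (rescale Q F)) =
      Matrix.of fun i j : Fin n => Q ^ (i : ℕ) * (Matrix.of fun i j : Fin n =>
        Q ^ ((j : ℕ) + t) * (Matrix.of fun i j : Fin n => coeff ((i : ℕ) + j + t) F) i j) i j := by
    ext i j
    simp only [Matrix.of_apply, coeff_rescale]
    ring
  rw [hankelDet_eq, hankelDet_eq, h, Matrix.det_mul_column, Matrix.det_mul_row, ← mul_assoc,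
    ← Finset.prod_mul_distrib, Finset.prod_range]
  congr 1
  refine Finset.prod_congr rfl fun i _ => ?_
  ring

variable (q : Rˣ)

/-- The integer power `q ^ e` of a unit, as an element of the ring. -/
def unitPow (e : ℤ) : R := ((q ^ e : Rˣ) : R)

theorem unitPow_add (e f : ℤ) : unitPow q (e + f) = unitPow q e * unitPow q f := by
  simp [unitPow, zpow_add]

theorem unitPow_zero : unitPow q 0 = 1 := by
  simp [unitPow]

theorem unitPow_pow (e : ℤ) (n : ℕ) : unitPow q e ^ n = unitPow q (e * n) := by
  simp [unitPow, zpow_mul]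

theorem unitPow_natCast (n : ℕ) : unitPow q n = (q : R) ^ n := by
  simp [unitPow]

theorem unitPow_sum {ι : Type*} (s : Finset ι) (f : ι → ℤ) :
    unitPow q (∑ i ∈ s, f i) = ∏ i ∈ s, unitPow q (f i) := by
  classical
  induction s using Finset.induction_on with
  | empty => simp [unitPow]
  | insert a s ha ih => rw [Finset.sum_insert ha, Finset.prod_insert ha, unitPow_add, ih]

theorem qSchroder_eq_moment (n : ℕ) : qSchroder (q : R) n =
    unitPow q ((n : ℤ) ^ 2) * moment (unitPow q (-1)) (unitPow q (-2)) n := by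
  induction n using Nat.strong_induction_on with
  | _ n ih =>
    rcases n with _ | n
    · simp [qSchroder, moment, unitPow_zero]
    · rw [qSchroder, moment, mul_add, Finset.mul_sum, ih n (by omega), ← unitPow_natCast,
        ← mul_assoc, ← unitPow_add]
      congr 1
      · congr 2; push_cast; ring
      · refine Finset.sum_congr rfl fun k _ => ?_
        rw [ih _ (by omega), ih _ (by omega), ← unitPow_natCast, unitPow_pow]
        have hk : (k : ℕ) ≤ n := by omega
        have hz : unitPow q ((2 * ((k : ℕ) + 1) * (n - k) : ℕ) : ℤ) *
            unitPow q (((n - k : ℕ) : ℤ) ^ 2) * unitPow q (((k : ℕ) : ℤ) ^ 2) =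
            unitPow q (((n + 1 : ℕ) : ℤ) ^ 2) * unitPow q (-1) * unitPow q (-2 * ((k : ℕ) : ℤ)) := by
          simp only [← unitPow_add]
          congr 1
          push_cast [Nat.cast_sub hk]
          ring
        linear_combination (moment (unitPow q (-1)) (unitPow q (-2)) (n - k) *
          moment (unitPow q (-1)) (unitPow q (-2)) k) * hz

/-- The Hankel determinant of the moments with parameters `a = q ^ (-(2 j + 1))`, `Q = q ^ (-2)`,
multiplied by the power of `q` that makes it `det S^{(t)}_n(q)` when `j = 0`. -/
noncomputable def scaledDet (t j n : ℕ) : R :=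
  unitPow q (∑ i ∈ range n, (2 * (i : ℤ) + t) ^ 2) *
    hankelDet t n (momentSeries (unitPow q (-(2 * (j : ℤ) + 1))) (unitPow q (-2)))

theorem det_qSchroderMatrix (t n : ℕ) : (qSchroderMatrix q t n).det = scaledDet q t 0 n := by
  -- `(i - j)(i - j - 1) + (i + j + t)² = (2 i² - i + 2 t i) + (2 j² + j + 2 t j + t²)`
  have h : qSchroderMatrix q t n =
      Matrix.of fun i j : Fin n => unitPow q (2 * (i : ℤ) ^ 2 - i + 2 * t * i) *
        (Matrix.of fun i j : Fin n => unitPow q (2 * (j : ℤ) ^ 2 + j + 2 * t * j + t ^ 2) *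
          (Matrix.of fun i j : Fin n => coeff ((i : ℕ) + j + t)
            (momentSeries (unitPow q (-1)) (unitPow q (-2)))) i j) i j := by
    ext i j
    simp only [qSchroderMatrix, Matrix.of_apply, qSchroder_eq_moment, momentSeries, coeff_mk]
    rw [← unitPow, ← mul_assoc, ← mul_assoc, ← unitPow_add, ← unitPow_add]
    congr 2
    push_cast
    ring
  rw [h, Matrix.det_mul_column, Matrix.det_mul_row, ← mul_assoc, ← Finset.prod_mul_distrib,
    ← hankelDet_eq, scaledDet, unitPow_sum, Finset.prod_range]
  congr 1
  refine Finset.prod_congr rfl fun i _ => ?_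
  rw [← unitPow_add]
  congr 1
  ring

/-- The factor `q ^ (2 j + 1) + 1`. -/
def oddFactor (j : ℕ) : R := (q : R) ^ (2 * j + 1) + 1

theorem one_add_unitPow (j : ℕ) : 1 + unitPow q (-(2 * (j : ℤ) + 1)) =
    unitPow q (-(2 * (j : ℤ) + 1)) * oddFactor q j := by
  rw [oddFactor, ← unitPow_natCast, mul_add, ← unitPow_add]
  push_cast
  rw [neg_add_cancel, unitPow_zero, mul_one]

theorem momentSeries_unitPow_continuedFraction (j : ℕ) :
    momentSeries (unitPow q (-(2 * (j : ℤ) + 1))) (unitPow q (-2)) *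
      (1 - C (unitPow q (-(2 * (j : ℤ) + 3))) * X * rescale (unitPow q (-2))
          (momentSeries (unitPow q (-(2 * ((j + 1 : ℕ) : ℤ) + 1))) (unitPow q (-2))) -
        C (unitPow q (-(2 * (j : ℤ) + 1)) * oddFactor q j) * X) =
      1 - C (unitPow q (-(2 * (j : ℤ) + 3))) * X * rescale (unitPow q (-2))
          (momentSeries (unitPow q (-(2 * ((j + 1 : ℕ) : ℤ) + 1))) (unitPow q (-2))) := by
  have h := momentSeries_continuedFraction (unitPow q (-(2 * (j : ℤ) + 1))) (unitPow q (-2))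
  rw [← unitPow_add, one_add_unitPow] at h
  rw [show -(2 * ((j + 1 : ℕ) : ℤ) + 1) = -(2 * (j : ℤ) + 1) + -2 by push_cast; ring,
    show -(2 * (j : ℤ) + 3) = -(2 * (j : ℤ) + 1) + -2 by ring]
  exact h

theorem prod_unitPow_neg_two (t n : ℕ) : ∏ i ∈ range n, unitPow q (-2) ^ (2 * i + t) =
    unitPow q (-2 * ((n : ℤ) * (n - 1) + t * n)) := by
  simp only [unitPow_pow, ← unitPow_sum]
  congr 1
  induction n with
  | zero => simp
  | succ n ih => rw [Finset.sum_range_succ, ih]; push_cast; ring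

theorem scaledDet_zero_succ (j n : ℕ) : scaledDet q 0 j (n + 1) =
    unitPow q (2 * (n : ℤ) ^ 2 - 2 * n * (2 * j + 1)) * oddFactor q j ^ n *
      scaledDet q 0 (j + 1) n := by
  rw [scaledDet, scaledDet, hankelDet_zero_succ (momentSeries_unitPow_continuedFraction q j),
    hankelDet_rescale, prod_unitPow_neg_two, Finset.sum_range_succ, unitPow_add]
  simp only [mul_pow, unitPow_pow]
  have hz : unitPow q ((2 * (n : ℤ) + (0 : ℕ)) ^ 2) * unitPow q (-(2 * (j : ℤ) + 1) * n) *
      unitPow q (-(2 * (j : ℤ) + 3) * n) * unitPow q (-2 * ((n : ℤ) * (n - 1) + (0 : ℕ) * n)) =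
      unitPow q (2 * (n : ℤ) ^ 2 - 2 * n * (2 * j + 1)) := by
    simp only [← unitPow_add]
    congr 1
    push_cast
    ring
  rw [← hz]
  ring

theorem scaledDet_one_succ (j n : ℕ) : scaledDet q 1 j (n + 1) =
    unitPow q (2 * (n : ℤ) ^ 2 - 2 * j * (2 * n + 1)) * oddFactor q j ^ (n + 1) *
      scaledDet q 1 (j + 1) n := by
  rw [scaledDet, scaledDet, hankelDet_one_succ (momentSeries_unitPow_continuedFraction q j),
    hankelDet_rescale, prod_unitPow_neg_two, Finset.sum_range_succ, unitPow_add]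
  simp only [mul_pow, unitPow_pow]
  have hz : unitPow q ((2 * (n : ℤ) + (1 : ℕ)) ^ 2) *
      unitPow q (-(2 * (j : ℤ) + 1) * (n + 1 : ℕ)) *
      unitPow q (-(2 * (j : ℤ) + 3) * n) * unitPow q (-2 * ((n : ℤ) * (n - 1) + (1 : ℕ) * n)) =
      unitPow q (2 * (n : ℤ) ^ 2 - 2 * j * (2 * n + 1)) := by
    simp only [← unitPow_add]
    congr 1
    push_cast
    ring
  rw [← hz]
  ring

theorem scaledDet_two_succ (j n : ℕ) : scaledDet q 2 j (n + 1) =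
    unitPow q (((n : ℤ) + 1) * (2 * n - 4 * j)) * oddFactor q j ^ (n + 1) *
      scaledDet q 0 (j + 1) (n + 1) +
    unitPow q (2 * (n : ℤ) ^ 2 + 2 * n + 2 - 4 * j - 4 * j * n) * oddFactor q j ^ (n + 2) *
      scaledDet q 2 (j + 1) n := by
  have hsum : ∀ n : ℕ, ∑ i ∈ range n, (2 * (i : ℤ) + (2 : ℕ)) ^ 2 =
      ∑ i ∈ range n, (2 * (i : ℤ) + (0 : ℕ)) ^ 2 + 4 * (n : ℤ) ^ 2 := fun n => by
    induction n with
    | zero => simp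
    | succ n ih => rw [Finset.sum_range_succ, Finset.sum_range_succ, ih]; push_cast; ring
  rw [scaledDet, hankelDet_two_succ (momentSeries_unitPow_continuedFraction q j),
    hankelDet_rescale, hankelDet_rescale, prod_unitPow_neg_two, prod_unitPow_neg_two, mul_add]
  congr 1
  · rw [scaledDet, hsum, unitPow_add]
    simp only [mul_pow, unitPow_pow]
    have hz : unitPow q (4 * ((n + 1 : ℕ) : ℤ) ^ 2) *
        unitPow q (-(2 * (j : ℤ) + 1) * (n + 1 : ℕ)) *
        unitPow q (-(2 * (j : ℤ) + 3) * (n + 1 : ℕ)) *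
        unitPow q (-2 * (((n + 1 : ℕ) : ℤ) * ((n + 1 : ℕ) - 1) + (0 : ℕ) * (n + 1 : ℕ))) =
        unitPow q (((n : ℤ) + 1) * (2 * n - 4 * j)) := by
      simp only [← unitPow_add]
      congr 1
      push_cast
      ring
    rw [← hz]
    ring
  · rw [scaledDet, Finset.sum_range_succ, unitPow_add]
    simp only [mul_pow, unitPow_pow]
    have hz : unitPow q ((2 * (n : ℤ) + (2 : ℕ)) ^ 2) *
        unitPow q (-(2 * (j : ℤ) + 1) * (2 : ℕ)) * unitPow q (-(2 * (j : ℤ) + 1) * n) *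
        unitPow q (-(2 * (j : ℤ) + 3) * n) *
        unitPow q (-2 * ((n : ℤ) * (n - 1) + (2 : ℕ) * n)) =
        unitPow q (2 * (n : ℤ) ^ 2 + 2 * n + 2 - 4 * j - 4 * j * n) := by
      simp only [← unitPow_add]
      congr 1
      push_cast
      ring
    rw [← hz]
    ring

/-- The product `∏ (q ^ (2 (j + k) + 1) + 1) ^ (n - k)` over `k < n`. -/
def oddProduct (j n : ℕ) : R := ∏ k ∈ range n, oddFactor q (j + k) ^ (n - k)

theorem oddProduct_succ (j n : ℕ) :
    oddProduct q j (n + 1) = oddFactor q j ^ (n + 1) * oddProduct q (j + 1) n := by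
  rw [oddProduct, oddProduct, Finset.prod_range_succ', mul_comm]
  congr 1
  refine Finset.prod_congr rfl fun k _ => ?_
  rw [Nat.add_sub_add_right, add_right_comm j 1 k, add_assoc j k 1]

/-- The power of `q` is trivial for `j = 0`. -/
theorem scaledDet_zero_eq (j n : ℕ) : scaledDet q 0 j (n + 1) =
    unitPow q (-2 * j * n * (n + 1)) * oddProduct q j n := by
  induction n generalizing j with
  | zero =>
    rw [scaledDet_zero_succ]
    simp [scaledDet, hankelDet, oddProduct, unitPow_zero]
  | succ n ih =>
    rw [scaledDet_zero_succ, ih, oddProduct_succ]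
    have hz : unitPow q (2 * ((n + 1 : ℕ) : ℤ) ^ 2 - 2 * (n + 1 : ℕ) * (2 * j + 1)) *
        unitPow q (-2 * (j + 1 : ℕ) * n * (n + 1)) =
        unitPow q (-2 * j * (n + 1 : ℕ) * ((n + 1 : ℕ) + 1)) := by
      simp only [← unitPow_add]
      congr 1
      push_cast
      ring
    rw [← hz]
    ring

theorem scaledDet_one_eq (j n : ℕ) : scaledDet q 1 j n =
    unitPow q (-2 * j * n ^ 2) * oddProduct q j n := by
  induction n generalizing j with
  | zero => simp [scaledDet, hankelDet, oddProduct, unitPow_zero]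
  | succ n ih =>
    rw [scaledDet_one_succ, ih, oddProduct_succ]
    have hz : unitPow q (2 * (n : ℤ) ^ 2 - 2 * j * (2 * n + 1)) *
        unitPow q (-2 * (j + 1 : ℕ) * n ^ 2) = unitPow q (-2 * j * (n + 1 : ℕ) ^ 2) := by
      simp only [← unitPow_add]
      congr 1
      push_cast
      ring
    rw [← hz]
    ring

theorem scaledDet_two_eq (j n : ℕ) : scaledDet q 2 j n =
    unitPow q (-2 * j * n * (n + 1) - (2 * j + 1)) * oddProduct q j n *
      (∏ k ∈ range (n + 1), oddFactor q (j + k) - 1) := by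
  induction n generalizing j with
  | zero =>
    have hz : unitPow q (-(2 * (j : ℤ) + 1)) * unitPow q ((2 * j + 1 : ℕ) : ℤ) = 1 := by
      rw [← unitPow_add, ← unitPow_zero q]
      congr 1
      push_cast
      ring
    rw [unitPow_natCast] at hz
    simp [scaledDet, hankelDet, oddProduct, unitPow_zero, oddFactor] at hz ⊢
    exact hz.symm
  | succ n ih =>
    have hprod : ∏ k ∈ range (n + 1 + 1), oddFactor q (j + k) =
        oddFactor q j * ∏ k ∈ range (n + 1), oddFactor q (j + 1 + k) := by
      rw [Finset.prod_range_succ', mul_comm]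
      simp only [add_zero, add_right_comm j 1, add_assoc]
    rw [scaledDet_two_succ, ih, scaledDet_zero_eq, oddProduct_succ, hprod]
    have h1 : unitPow q (((n : ℤ) + 1) * (2 * n - 4 * j)) *
        unitPow q (-2 * (j + 1 : ℕ) * n * (n + 1)) =
        unitPow q (-2 * j * (n + 1 : ℕ) * ((n + 1 : ℕ) + 1) - (2 * j + 1)) *
          unitPow q ((2 * j + 1 : ℕ) : ℤ) := by
      simp only [← unitPow_add]
      congr 1
      push_cast
      ring
    have h2 : unitPow q (2 * (n : ℤ) ^ 2 + 2 * n + 2 - 4 * j - 4 * j * n) *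
        unitPow q (-2 * (j + 1 : ℕ) * n * (n + 1) - (2 * (j + 1 : ℕ) + 1)) =
        unitPow q (-2 * j * (n + 1 : ℕ) * ((n + 1 : ℕ) + 1) - (2 * j + 1)) := by
      simp only [← unitPow_add]
      congr 1
      push_cast
      ring
    have h3 : unitPow q ((2 * j + 1 : ℕ) : ℤ) = oddFactor q j - 1 := by
      rw [unitPow_natCast, oddFactor, add_sub_cancel_right]
    rw [h3] at h1
    linear_combination oddFactor q j ^ (n + 1) * oddProduct q (j + 1) n * h1 +
      oddFactor q j ^ (n + 2) * oddProduct q (j + 1) n *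
        (∏ k ∈ range (n + 1), oddFactor q (j + 1 + k) - 1) * h2

theorem prod_Icc_one_eq_prod_range (f : ℕ → R) (n : ℕ) :
    ∏ k ∈ Finset.Icc 1 n, f k = ∏ k ∈ range n, f (k + 1) := by
  induction n with
  | zero => simp
  | succ n ih => rw [Finset.prod_Icc_succ_top (by omega), ih, Finset.prod_range_succ]

theorem oddFactor_eq (k : ℕ) : oddFactor q k = (q : R) ^ (2 * (k + 1) - 1) + 1 := rfl

theorem prod_Icc_eq_oddProduct (n : ℕ) :
    ∏ k ∈ Finset.Icc 1 n, ((q : R) ^ (2 * k - 1) + 1) ^ (n + 1 - k) = oddProduct q 0 n := by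
  rw [prod_Icc_one_eq_prod_range, oddProduct]
  refine Finset.prod_congr rfl fun k _ => ?_
  rw [zero_add, oddFactor_eq, Nat.add_sub_add_right]

end

theorem mainTheorem1 {R : Type*} [CommRing R] (q : Rˣ) :
    (∀ n : ℕ, qSchroder (q : R) n =
      ∑ P ∈ (schroderPaths_finite n).toFinset, schroderWeight q 0 0 P) ∧
    ∀ n : ℕ, 1 ≤ n →
      ((qSchroderMatrix q 1 (n - 1)).det = (qSchroderMatrix q 0 n).det ∧
        (qSchroderMatrix q 0 n).det =
          ∏ k ∈ Finset.Icc 1 (n - 1), ((q : R) ^ (2 * k - 1) + 1) ^ (n - k)) ∧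
      (qSchroderMatrix q 2 n).det =
        ((q⁻¹ : Rˣ) : R) * (∏ k ∈ Finset.Icc 1 n, ((q : R) ^ (2 * k - 1) + 1) ^ (n + 1 - k)) *
          ((∏ k ∈ Finset.Icc 1 (n + 1), ((q : R) ^ (2 * k - 1) + 1)) - 1) := by
  refine ⟨fun n => ?_, fun n hn => ?_⟩
  · rw [toFinset_schroderPaths, qSchroder_eq_suffixWeight, suffixWeight]
  · obtain ⟨m, rfl⟩ : ∃ m, n = m + 1 := ⟨n - 1, by omega⟩
    simp only [det_qSchroderMatrix, Nat.add_sub_cancel, prod_Icc_eq_oddProduct,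
      scaledDet_zero_eq, scaledDet_one_eq, scaledDet_two_eq]
    rw [prod_Icc_one_eq_prod_range (fun k => (q : R) ^ (2 * k - 1) + 1)]
    refine ⟨⟨?_, ?_⟩, ?_⟩
    · simp
    · simp [unitPow_zero]
    · simp [oddFactor_eq, unitPow]
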